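/- Let $G$ be a real, connected, compact Lie group whose Lie algebra $\mathfrak g$ is semisimple. Let $\kappa$ be the Killing form of $\mathfrak g$, and equip $G$ with the (bi-invariant) Riemannian metric $\langle v,w\rangle_g=-\kappa\big((dL_{g^{-1}})_g v,(dL_{g^{-1}})_g w\big)$ for $v,w\in T_gG$, where $L_x$ denotes left translation by $x$. Let $\rho$ be the associated Riemannian distance, $$\rho(x,y)=\inf_{\sigma}\int_0^1\langle\dot\sigma(s),\dot\sigma(s)\rangle^{1/2}\,ds ,$$ the infimum being taken over all $C^1$ curves $\sigma:[0,1]\to G$ with $\sigma(0)=x$ and $\sigma(1)=y$. Let $\mathcal X$ be a linear vector field on $G$, that is, a smooth vector field whose flow $(\varphi_t)_{t\in\mathbb R}$ consists of Lie group automorphisms of $G$. Then, for every $t\in\mathbb R$, the map $\varphi_t$ is an isometry of $(G,\rho)$: it is a bijection of $G$ and $$\rho(\varphi_t(g),\varphi_t(h))=\rho(g,h)\qquad\text{for all } g,h\in G .$$ -/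

import Mathlib

open scoped Manifold ContDiff

noncomputable section

namespace KillingIsometry

variable {E : Type*} [NormedAddCommGroup E] [NormedSpace ℝ E]
  {H : Type*} [TopologicalSpace H] (I : ModelWithCorners ℝ E H)
  {G : Type*} [TopologicalSpace G] [ChartedSpace H G] [Group G]

/-- A smooth real Lie group has the regularity under which Mathlib puts the Lie bracket on its
tangent space at the identity. -/
instance instLieGroupMinSmoothness [LieGroup I ∞ G] : LieGroup I (minSmoothness ℝ 3) G := by
  rw [minSmoothness_of_isRCLikeNormedField]
  exact LieGroup.of_le (n := ∞) (ENat.LEInfty.out)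

/-- `f` is an automorphism of the Lie group `G`: a group automorphism that is smooth together with
its inverse. -/
def IsLieGroupAutomorphism (f : G → G) : Prop :=
  ∃ e : G ≃* G, ⇑e = f ∧ ContMDiff I I ∞ e ∧ ContMDiff I I ∞ e.symm

/-- `φ` is the (global) flow of the vector field `X`: `t ↦ φ t g` is the solution on `ℝ` of
`ġ = X(g)` starting at `g`. -/
structure IsFlowOf (X : (g : G) → TangentSpace I g) (φ : ℝ → G → G) : Prop where
  map_zero : ∀ g, φ 0 g = g
  isMIntegralCurve : ∀ g, IsMIntegralCurve (I := I) (fun t ↦ φ t g) X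

/-- A linear vector field on a Lie group: a smooth vector field whose flow is a family of
automorphisms of the Lie group. -/
structure IsLinearVectorField [LieGroup I ∞ G] (X : (g : G) → TangentSpace I g) : Prop where
  contMDiff : ContMDiff I I.tangent ∞ (fun g ↦ (⟨g, X g⟩ : TangentBundle I G))
  exists_flow : ∃ φ : ℝ → G → G, IsFlowOf I X φ ∧ ∀ t, IsLieGroupAutomorphism I (φ t)

/-- The tangent vector `v` at `g`, carried to the Lie algebra by the differential of the left
translation by `g⁻¹`. -/
def toLieAlgebra (g : G) (v : TangentSpace I g) : GroupLieAlgebra I G :=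
  mfderiv I I (fun h : G ↦ g⁻¹ * h) g v

variable [CompleteSpace E] [LieGroup I ∞ G]

/-- The left-invariant extension to `G` of the negative of the Killing form of the Lie algebra
(for `G` compact and semisimple, a bi-invariant Riemannian metric). -/
def killingMetric (g : G) (v w : TangentSpace I g) : ℝ :=
  -killingForm ℝ (GroupLieAlgebra I G) (toLieAlgebra I g v) (toLieAlgebra I g w)

/-- The length `⟨v, v⟩ ^ (1 / 2)` of a tangent vector for the negative of the Killing form.
On a compact semisimple group the radicand is nonnegative, as the Killing form is negative
definite. -/
abbrev killingENorm (g : G) : ENorm (TangentSpace I g) where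
  enorm v := ENNReal.ofReal √(killingMetric I g v v)

/-- The Riemannian distance of the metric given by the negative of the Killing form: the infimum
of the lengths `∫₀¹ ⟨σ'(s), σ'(s)⟩ ^ (1 / 2) ds` of the `C¹` curves `σ` from `x` to `y`. -/
def killingEDist (x y : G) : ENNReal :=
  letI : ∀ g : G, ENorm (TangentSpace I g) := killingENorm I
  Manifold.riemannianEDist I x y

end KillingIsometry

end

open scoped Manifold ContDiff

noncomputable section

namespace KillingIsometry

open VectorField

variable {E : Type*} [NormedAddCommGroup E] [NormedSpace ℝ E]
  {H : Type*} [TopologicalSpace H] {I : ModelWithCorners ℝ E H}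
  {G : Type*} [TopologicalSpace G] [ChartedSpace H G]

/-! An automorphism `e` satisfies `e ∘ L_g = L_{e g} ∘ e`, so in the left trivialization its
differential is the same map `de₁` at every point (`toLieAlgebra_mfderiv`). This map is a Lie
algebra automorphism (`differential_lie`), and the Killing form, being a trace of `ad x ∘ ad y`, is
invariant under those. Hence `e` preserves the metric, the lengths of `C¹` curves, and the distance.
-/

/-- A flow of a `C¹` vector field on a boundaryless Hausdorff manifold is unique. -/
lemma IsFlowOf.eq_of_contMDiff [CompleteSpace E] [T2Space G] [BoundarylessManifold I G]
    [IsManifold I 1 G] {X : (g : G) → TangentSpace I g} {φ ψ : ℝ → G → G}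
    (hX : ContMDiff I I.tangent 1 (fun g ↦ (⟨g, X g⟩ : TangentBundle I G)))
    (hφ : IsFlowOf I X φ) (hψ : IsFlowOf I X ψ) : φ = ψ := by
  funext t g
  exact congrFun (isMIntegralCurve_Ioo_eq_of_contMDiff_boundaryless (t₀ := 0) hX
    (hφ.isMIntegralCurve g) (hψ.isMIntegralCurve g)
    ((hφ.map_zero g).trans (hψ.map_zero g).symm)) t

variable [Group G] [LieGroup I ∞ G]

lemma mdifferentiableAt_mul_left (g x : G) : MDifferentiableAt I I (fun h : G ↦ g * h) x :=
  (contMDiff_mul_left (I := I) (n := ∞)).mdifferentiableAt (by simp)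

variable (I) in
/-- The differential at the identity of an endomorphism of a Lie group, as an endomorphism of the
Lie algebra. -/
def differential (e : G →* G) : GroupLieAlgebra I G →L[ℝ] GroupLieAlgebra I G :=
  mfderiv I I e 1

/-- The differential of a smooth group endomorphism carries left-invariant vector fields to
left-invariant vector fields. -/
lemma mfderiv_mulInvariantVectorField (e : G →* G) (he : MDifferentiable I I e)
    (v : GroupLieAlgebra I G) (g : G) :
    mfderiv I I e g (mulInvariantVectorField v g) =
      mulInvariantVectorField (differential I e v) (e g) := by
  have h₁ : mfderiv I I (e ∘ fun h ↦ g * h) (1 : G) =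
      (mfderiv I I e (g * 1)).comp (mfderiv I I (fun h ↦ g * h) (1 : G)) :=
    mfderiv_comp _ (he _) (mdifferentiableAt_mul_left g 1)
  have h₂ : mfderiv I I ((fun h ↦ e g * h) ∘ e) (1 : G) =
      (mfderiv I I (fun h ↦ e g * h) (e 1)).comp (mfderiv I I e 1) :=
    mfderiv_comp _ (mdifferentiableAt_mul_left _ _) (he _)
  have h₃ : (e ∘ fun h ↦ g * h) = (fun h ↦ e g * h) ∘ e := by ext; simp
  have h₄ := (h₁.symm.trans (h₃ ▸ rfl)).trans h₂
  rw [mul_one, map_one] at h₄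
  exact DFunLike.congr_fun h₄ v

/-- The differential at `g` of a smooth group endomorphism, read in the left trivialization of the
tangent bundle, is its differential at the identity. -/
lemma toLieAlgebra_mfderiv (e : G →* G) (he : MDifferentiable I I e) (g : G)
    (v : TangentSpace I g) :
    toLieAlgebra I (e g) (mfderiv I I e g v) = differential I e (toLieAlgebra I g v) := by
  have h₁ : mfderiv I I (e ∘ fun h ↦ g⁻¹ * h) g =
      (mfderiv I I e (g⁻¹ * g)).comp (mfderiv I I (fun h ↦ g⁻¹ * h) g) :=
    mfderiv_comp _ (he _) (mdifferentiableAt_mul_left _ _)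
  have h₂ : mfderiv I I ((fun h ↦ (e g)⁻¹ * h) ∘ e) g =
      (mfderiv I I (fun h ↦ (e g)⁻¹ * h) (e g)).comp (mfderiv I I e g) :=
    mfderiv_comp _ (mdifferentiableAt_mul_left _ _) (he _)
  have h₃ : (e ∘ fun h ↦ g⁻¹ * h) = (fun h ↦ (e g)⁻¹ * h) ∘ e := by ext; simp
  -- `g⁻¹ * g` equals `1` only propositionally, so the two differentials have different types;
  -- comparing values in `E` allows `subst`.
  have h₄ (x : G) (hx : x = 1) (w : E) : (mfderiv I I e x w : E) = mfderiv I I e 1 w := by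
    subst hx; rfl
  exact (DFunLike.congr_fun ((h₂.symm.trans (h₃ ▸ rfl)).trans h₁) v).trans
    (h₄ _ (inv_mul_cancel g) _)

variable [CompleteSpace E]

/-- A smooth automorphism of a Lie group as a diffeomorphism. -/
def toDiffeomorph (e : G ≃* G) (he : ContMDiff I I ∞ e) (he' : ContMDiff I I ∞ e.symm) :
    G ≃ₘ^∞⟮I, I⟯ G :=
  ⟨e.toEquiv, he, he'⟩

/-- The differential at the identity of an automorphism of a Lie group respects the Lie bracket. -/
lemma differential_lie (e : G ≃* G) (he : ContMDiff I I ∞ e) (he' : ContMDiff I I ∞ e.symm)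
    (v w : GroupLieAlgebra I G) :
    differential I e.toMonoidHom ⁅v, w⁆ =
      ⁅differential I e.toMonoidHom v, differential I e.toMonoidHom w⁆ := by
  have hd : MDifferentiable I I e := he.mdifferentiable (by simp)
  -- `mpullback` uses `ContinuousLinearMap.inverse`, which is zero on a non-invertible map.
  have inv (g : G) : (mfderiv I I e g).IsInvertible :=
    ⟨(toDiffeomorph e he he').mfderivToContinuousLinearEquiv (by simp) g, rfl⟩
  have pull (u : GroupLieAlgebra I G) :
      mpullback I I e (mulInvariantVectorField (differential I e.toMonoidHom u)) =
        mulInvariantVectorField u := by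
    ext g
    rw [mpullback_apply]
    have := mfderiv_mulInvariantVectorField e.toMonoidHom hd u g
    exact (inv g).inverse_apply_eq.2 this.symm
  -- The bracket of the Lie algebra is that of left-invariant fields at `1`, and pullback commutes
  -- with brackets of fields.
  have key := mpullback_mlieBracket (n := ∞) (f := e) (x₀ := (1 : G)) (I := I) (I' := I)
    (mdifferentiableAt_mulInvariantVectorField (differential I e.toMonoidHom v))
    (mdifferentiableAt_mulInvariantVectorField (differential I e.toMonoidHom w)) he.contMDiffAt
    (by rw [minSmoothness_of_isRCLikeNormedField]; exact ENat.LEInfty.out)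
  rw [pull, pull, mpullback_apply] at key
  have := (inv 1).inverse_apply_eq.1 key
  exact this.symm.trans (by rw [map_one]; rfl)

/-- The differential at the identity of an automorphism of a Lie group, as an automorphism of the
Lie algebra. -/
def differentialLieEquiv (e : G ≃* G) (he : ContMDiff I I ∞ e) (he' : ContMDiff I I ∞ e.symm) :
    GroupLieAlgebra I G ≃ₗ⁅ℝ⁆ GroupLieAlgebra I G :=
  { ((toDiffeomorph e he he').mfderivToContinuousLinearEquiv (by simp) 1).toLinearEquiv with
    map_lie' := differential_lie e he he' _ _ }

/-- Automorphisms of a Lie group preserve the left-invariant extension of the Killing form. -/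
lemma killingMetric_mfderiv (e : G ≃* G) (he : ContMDiff I I ∞ e) (he' : ContMDiff I I ∞ e.symm)
    (g : G) (v w : TangentSpace I g) :
    killingMetric I (e g) (mfderiv I I e g v) (mfderiv I I e g w) = killingMetric I g v w := by
  have h (u : TangentSpace I g) : toLieAlgebra I (e g) (mfderiv I I e g u) =
      differentialLieEquiv e he he' (toLieAlgebra I g u) :=
    toLieAlgebra_mfderiv e.toMonoidHom (he.mdifferentiable (by simp)) g u
  rw [killingMetric, h, h, LieAlgebra.killingForm_of_equiv_apply, killingMetric]

/-- Automorphisms of a Lie group do not increase the distance given by the Killing form. -/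
lemma killingEDist_map_le (e : G ≃* G) (he : ContMDiff I I ∞ e) (he' : ContMDiff I I ∞ e.symm)
    (x y : G) : killingEDist I (e x) (e y) ≤ killingEDist I x y := by
  rw [killingEDist, killingEDist, Manifold.riemannianEDist, Manifold.riemannianEDist]
  refine le_iInf₂ fun γ hγ ↦ ?_
  have hγ' : ContMDiff (𝓡∂ 1) I 1 (γ.map he.continuous) :=
    (he.of_le ENat.LEInfty.out).comp hγ
  refine (iInf₂_le (γ.map he.continuous) hγ').trans_eq (MeasureTheory.lintegral_congr fun s ↦ ?_)
  have hs : mfderiv (𝓡∂ 1) I (e ∘ γ) s = (mfderiv I I e (γ s)).comp (mfderiv (𝓡∂ 1) I γ s) :=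
    mfderiv_comp _ (he.mdifferentiable (by simp) _) (hγ.mdifferentiable (by simp) _)
  change ENNReal.ofReal √(killingMetric I (e (γ s)) (mfderiv (𝓡∂ 1) I (e ∘ γ) s 1)
    (mfderiv (𝓡∂ 1) I (e ∘ γ) s 1)) = ENNReal.ofReal √(killingMetric I (γ s) _ _)
  rw [hs]
  exact congrArg (fun r ↦ ENNReal.ofReal √r) (killingMetric_mfderiv e he he' (γ s) _ _)

/-- Automorphisms of a Lie group preserve the distance given by the Killing form. -/
lemma killingEDist_map (e : G ≃* G) (he : ContMDiff I I ∞ e) (he' : ContMDiff I I ∞ e.symm)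
    (x y : G) : killingEDist I (e x) (e y) = killingEDist I x y := by
  refine (killingEDist_map_le e he he' x y).antisymm ?_
  simpa using killingEDist_map_le e.symm he' he (e x) (e y)

end KillingIsometry

end

theorem mainTheorem9
    {E : Type*} [NormedAddCommGroup E] [NormedSpace ℝ E] [FiniteDimensional ℝ E] [CompleteSpace E]
    {H : Type*} [TopologicalSpace H] (I : ModelWithCorners ℝ E H)
    {G : Type*} [TopologicalSpace G] [ChartedSpace H G] [Group G] [LieGroup I ∞ G]
    [BoundarylessManifold I G] [T2Space G] [ConnectedSpace G] [CompactSpace G]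
    [LieAlgebra.IsSemisimple ℝ (GroupLieAlgebra I G)]
    (X : (g : G) → TangentSpace I g) (hX : KillingIsometry.IsLinearVectorField I X)
    (φ : ℝ → G → G) (hφ : KillingIsometry.IsFlowOf I X φ) (t : ℝ) :
    Function.Bijective (φ t) ∧
      ∀ g h : G, KillingIsometry.killingEDist I (φ t g) (φ t h) =
        KillingIsometry.killingEDist I g h := by
  obtain ⟨ψ, hψ, hψ'⟩ := hX.exists_flow
  have : IsManifold I 1 G := IsManifold.of_le (n := ∞) ENat.LEInfty.out
  -- Linearity of `X` only provides some flow by automorphisms; uniqueness identifies it with `φ`.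
  obtain rfl : φ = ψ := hφ.eq_of_contMDiff (hX.contMDiff.of_le ENat.LEInfty.out) hψ
  obtain ⟨e, he, h, h'⟩ := hψ' t
  rw [← he]
  exact ⟨e.bijective, KillingIsometry.killingEDist_map e h h'⟩
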